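/- **Six-vertex LGV Lemma.** Let $R$ be a commutative ring, $N\ge 0$, and let $x_i,y_i,A_i,B_i\in R$ $(1\le i\le N)$ be row parameters; for the dual model $\mathfrak{S}^*$ the $A_i,B_i$ are assumed invertible. *The models.* A state is an assignment of spins $+$ or $-$ to all edges of a rectangular grid with $N$ rows and $M$ columns, the columns being labelled $0,\ldots,M-1$ from left to right. Describe a vertex by its four spins (left, top, right, bottom). In row $i$, the nonzero Boltzmann weights of $\mathfrak{S}$ are $$(+,+,+,+)\mapsto A_i,\quad (-,-,-,-)\mapsto y_iA_iB_i,\quad (+,-,+,-)\mapsto A_iB_i,$$ $$(-,+,-,+)\mapsto x_iA_i,\quad (-,+,+,-)\mapsto (x_i+y_i)A_iB_i,\quad (+,-,-,+)\mapsto A_i,$$ and those of $\mathfrak{S}^*$ are $$(+,+,+,+)\mapsto A_i^{-1},\quad (-,-,-,-)\mapsto x_iA_i^{-1}B_i^{-1},\quad (+,-,+,-)\mapsto A_i^{-1}B_i^{-1},$$ $$(-,+,-,+)\mapsto y_iA_i^{-1},\quad (+,+,-,-)\mapsto (x_i+y_i)A_i^{-1},\quad (-,-,+,+)\mapsto A_i^{-1}B_i^{-1};$$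 all other vertices have weight $0$. For finite sequences $\lambda,\mu$ of distinct nonnegative integers smaller than $M$, the model $\mathfrak{S}_{\lambda/\mu}$ has rows labelled $1,\ldots,N$ from bottom to top, all left and right boundary edges equal to $+$, bottom boundary edges $-$ exactly in the columns labelled by parts of $\lambda$, and top boundary edges $-$ exactly in the columns labelled by parts of $\mu$. The model $\mathfrak{S}^*_{\lambda/\mu}$ is defined in the same way with the $\mathfrak{S}^*$ weights, but with rows labelled from top to bottom, $\lambda$ on the top boundary and $\mu$ on the bottom boundary. The partition function $Z$ of a model is the sum, over all states with the given boundary spins, of the product of the Boltzmann weights of all vertices. *Statement.* Let $\lambda=(\lambda_1>\cdots>\lambda_\ell\ge 0)$ and $\mu=(\mu_1>\cdots>\mu_\ell\ge 0)$ be strict partitions of the same length $\ell=\ell(\lambda)=\ell(\mu)$ (a part may be $0$). Then $$Z(\mathfrak{S}_{\lambda/\mu})=\det_{1\le i,j\le \ell} Z(\mathfrak{S}_{(\lambda_i)/(\mu_j)})\qquad\text{and}\qquad Z(\mathfrak{S}^*_{\lambda/\mu})=\det_{1\le i,j\le \ell} Z(\mathfrak{S}^*_{(\lambda_i)/(\mu_j)}),$$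 where all models have the same $N$ rows with the same row parameters, the models on the left side have $M$ columns, the model in entry $(i,j)$ on the right side has $M_{ij}>\max(\lambda_i,\mu_j)$ columns, and these numbers satisfy $M=\sum_{i=1}^{\ell} M_{i,\sigma(i)}$ for all permutations $\sigma$ of $\{1,\ldots,\ell\}$. -/

import Mathlib

namespace SixVertex

/-- The two spins of the six-vertex model; `minus` marks the presence of a particle. -/
inductive Spin : Type
  | plus : Spin
  | minus : Spin
  deriving DecidableEq

instance : Fintype Spin where
  elems := {.plus, .minus}
  complete := by intro s; cases s <;> decide

/-- The Boltzmann weights of the model `𝔖` in a row with parameters `x, y, A, B`, as a function of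
the spins on the left (west), top (north), right (east) and bottom (south) edge of a vertex.
The six admissible vertices are listed in the order `a₁, a₂, b₁, b₂, c₁, c₂`;
all other vertices have weight zero. -/
def weight {R : Type*} [CommRing R] (x y A B : R) (west north east south : Spin) : R :=
  match west, north, east, south with
  | .plus, .plus, .plus, .plus => A
  | .minus, .minus, .minus, .minus => y * A * B
  | .plus, .minus, .plus, .minus => A * B
  | .minus, .plus, .minus, .plus => x * A
  | .minus, .plus, .plus, .minus => (x + y) * A * B
  | .plus, .minus, .minus, .plus => A
  | _, _, _, _ => 0

/-- The Boltzmann weights of the dual model `𝔖*`, with the same conventions; the parameters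
`A, B` have to be invertible. -/
def weightStar {R : Type*} [CommRing R] (x y : R) (A B : Rˣ)
    (west north east south : Spin) : R :=
  match west, north, east, south with
  | .plus, .plus, .plus, .plus => (↑A⁻¹ : R)
  | .minus, .minus, .minus, .minus => x * (↑A⁻¹ : R) * (↑B⁻¹ : R)
  | .plus, .minus, .plus, .minus => (↑A⁻¹ : R) * (↑B⁻¹ : R)
  | .minus, .plus, .minus, .plus => y * (↑A⁻¹ : R)
  | .plus, .plus, .minus, .minus => (x + y) * (↑A⁻¹ : R)
  | .minus, .minus, .plus, .plus => (↑A⁻¹ : R) * (↑B⁻¹ : R)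
  | _, _, _, _ => 0

/-- An assignment of spins to all edges of a rectangular grid with `N` rows and `m` columns.
The columns are labelled `0, …, m - 1` from left to right. The rows are labelled `0, …, N - 1`,
from bottom to top in `𝔖` and from top to bottom in `𝔖*`.

* `s.1 k c` is the spin of the vertical edge in column `c` that precedes row `k` (and follows
  row `k - 1`) in the order of the row labels; so `k = 0` and `k = N` are boundary edges.
* `s.2 i c` is the spin of the horizontal edge in row `i` directly to the left of column `c`
  (and to the right of column `c - 1`); so `c = 0` and `c = m` are boundary edges. -/
abbrev Config (N m : ℕ) : Type :=
  (Fin (N + 1) → Fin m → Spin) × (Fin N → Fin (m + 1) → Spin)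

/-- The boundary spins given by a sequence of parts: `-` on the columns labelled by a part,
and `+` on all other columns. -/
def boundarySpin {ℓ : ℕ} (m : ℕ) (part : Fin ℓ → ℕ) (c : Fin m) : Spin :=
  if ∃ i, part i = (c : ℕ) then .minus else .plus

/-- The boundary conditions of `𝔖_{λ/μ}` (bottom `λ`, top `μ`) and of `𝔖*_{λ/μ}`
(top `λ`, bottom `μ`): in both cases `λ` bounds the first row and `μ` bounds the last one.
The left and right boundary edges are all `+`. -/
def HasBoundary {N m ℓ k : ℕ} (lam : Fin ℓ → ℕ) (mu : Fin k → ℕ) (s : Config N m) : Prop :=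
  s.1 0 = boundarySpin m lam ∧ s.1 (Fin.last N) = boundarySpin m mu ∧
    ∀ i, s.2 i 0 = .plus ∧ s.2 i (Fin.last m) = .plus

instance {N m ℓ k : ℕ} (lam : Fin ℓ → ℕ) (mu : Fin k → ℕ) :
    DecidablePred (HasBoundary (N := N) (m := m) lam mu) :=
  fun s => by unfold HasBoundary; infer_instance

/-- The partition function `Z(𝔖_{λ/μ}(x; y; A; B))` of the model with `N` rows and `m` columns.
Rows go from bottom to top, so row `i` has the vertical edges `i` below it and `i + 1` above it. -/
def Z {R : Type*} [CommRing R] {N ℓ k : ℕ} (x y A B : Fin N → R)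
    (m : ℕ) (lam : Fin ℓ → ℕ) (mu : Fin k → ℕ) : R :=
  ∑ s : Config N m with HasBoundary lam mu s, ∏ i : Fin N, ∏ c : Fin m,
    weight (x i) (y i) (A i) (B i)
      (west := s.2 i c.castSucc) (north := s.1 i.succ c)
      (east := s.2 i c.succ) (south := s.1 i.castSucc c)

/-- The partition function `Z(𝔖*_{λ/μ}(x; y; A; B))` of the model with `N` rows and `m` columns.
Rows go from top to bottom, so row `i` has the vertical edges `i` above it and `i + 1` below it. -/
def ZStar {R : Type*} [CommRing R] {N ℓ k : ℕ} (x y : Fin N → R) (A B : Fin N → Rˣ)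
    (m : ℕ) (lam : Fin ℓ → ℕ) (mu : Fin k → ℕ) : R :=
  ∑ s : Config N m with HasBoundary lam mu s, ∏ i : Fin N, ∏ c : Fin m,
    weightStar (x i) (y i) (A i) (B i)
      (west := s.2 i c.castSucc) (north := s.1 i.castSucc c)
      (east := s.2 i c.succ) (south := s.1 i.succ c)

end SixVertex

/-!
A free-fermionic row acts on any number of particles as an exterior power of its action on one
particle. To see this, represent the spins of a row of vertical edges by the wedge product, from
right to left, of the basis vectors of the columns that carry a particle. Sweeping through the row
from left to right, one vertex at a time, the free fermion condition shows that the row acts on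
these wedge products as `a ^ M` times the exterior algebra map of a linear operator on
one-particle states. This operator does not depend on the number `M` of columns, because particles
only move to the left. By functoriality the same holds for a stack of rows, so a partition
function with `ℓ` particles is `(∏ a) ^ M` times an `ℓ × ℓ` minor of the one-particle operator.
The powers of `∏ a` on the two sides of the determinant formula agree by the assumption on the
numbers of columns.
-/

namespace SixVertex

section General

variable {R : Type*}

theorem sum_spin {G : Type*} [AddCommMonoid G] (f : Spin → G) :
    ∑ s, f s = f .plus + f .minus :=
  Finset.sum_pair (by decide)

theorem sum_snoc {α G : Type*} [Fintype α] [AddCommMonoid G] {n : ℕ}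
    (f : (Fin (n + 1) → α) → G) :
    ∑ v, f v = ∑ a, ∑ v : Fin n → α, f (Fin.snoc v a) := by
  rw [← (Fin.snocEquiv fun _ => α).sum_comp, Fintype.sum_prod_type]
  rfl

theorem prod_ofFn_apply [CommSemiring R] {α : Type*} [Fintype α] [DecidableEq α] {n : ℕ}
    (w : Fin n → Matrix α α R) (a b : α) :
    (List.ofFn w).prod a b = ∑ v : Fin (n + 1) → α with v 0 = a ∧ v (Fin.last n) = b,
      ∏ i, w i (v i.castSucc) (v i.succ) := by
  rw [Finset.sum_filter]
  induction n generalizing a with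
  | zero =>
    rw [← (Equiv.funUnique (Fin 1) α).symm.sum_comp]
    simp [Matrix.one_apply, ite_and]
  | succ n ih =>
    rw [← (Fin.consEquiv fun _ => α).sum_comp, Fintype.sum_prod_type, Finset.sum_comm,
      List.ofFn_succ, List.prod_cons, Matrix.mul_apply]
    simp only [ih, Finset.mul_sum]
    rw [Finset.sum_comm]
    refine Finset.sum_congr rfl fun v _ => ?_
    simp [Fin.consEquiv, Fin.prod_univ_succ, ← Fin.succ_last, ite_and]

theorem exists_strictAnti_range_eq {α : Type*} [LinearOrder α] (t : Finset α) :
    ∃ f : Fin t.card → α, StrictAnti f ∧ Set.range f = t :=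
  ⟨t.orderEmbOfFin rfl ∘ Fin.rev,
    (t.orderEmbOfFin rfl).strictMono.comp_strictAnti Fin.rev_strictAnti,
    by rw [Fin.rev_surjective.range_comp, t.range_orderEmbOfFin rfl]⟩

theorem le_of_forall_eq_sum_perm {ι : Type*} [Fintype ι] {m : ι → ι → ℕ} {M : ℕ}
    (hM : ∀ σ : Equiv.Perm ι, M = ∑ i, m i (σ i)) (i j : ι) : m i j ≤ M := by
  classical
  rw [hM (Equiv.swap i j)]
  simpa using Finset.single_le_sum (f := fun k => m k (Equiv.swap i j k))
    (fun _ _ => Nat.zero_le _) (Finset.mem_univ i)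

variable [CommRing R] {ι α : Type*} [Fintype ι] [DecidableEq ι]

theorem det_of_pow_mul {m : ι → ι → ℕ} {M : ℕ} (hM : ∀ σ : Equiv.Perm ι, M = ∑ i, m i (σ i))
    (a : R) (B : ι → ι → R) :
    (Matrix.of fun i j => a ^ m i j * B i j).det = a ^ M * (Matrix.of B).det := by
  rw [← Matrix.det_transpose, ← Matrix.det_transpose (Matrix.of B), Matrix.det_apply,
    Matrix.det_apply, Finset.mul_sum]
  refine Finset.sum_congr rfl fun σ _ => ?_
  simp only [Matrix.transpose_apply, Matrix.of_apply, Finset.prod_mul_distrib,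
    Finset.prod_pow_eq_pow_sum, ← hM σ, mul_smul_comm]

theorem det_single_self {f : ι → α} (hf : f.Injective) :
    (Matrix.of fun i j => Finsupp.single (f i) (1 : R) (f j)).det = 1 := by
  classical
  rw [← Matrix.det_one (n := ι)]
  congr 1
  ext i j
  simp [Finsupp.single_apply, Matrix.one_apply, hf.eq_iff]

theorem det_single_of_range_ne {f g : ι → α} (h : Set.range f ≠ Set.range g) :
    (Matrix.of fun i j => Finsupp.single (f i) (1 : R) (g j)).det = 0 := by
  rw [Ne, Set.Subset.antisymm_iff, not_and_or, Set.range_subset_iff, Set.range_subset_iff] at h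
  push Not at h
  obtain ⟨i, hi⟩ | ⟨j, hj⟩ := h
  · exact Matrix.det_eq_zero_of_row_eq_zero i fun j =>
      Finsupp.single_eq_of_ne fun hij => hi ⟨j, hij⟩
  · exact Matrix.det_eq_zero_of_column_eq_zero j fun i =>
      Finsupp.single_eq_of_ne fun hij => hj ⟨i, hij.symm⟩

end General

variable {R : Type*} [CommRing R]

section Minor

variable {α : Type*} {ℓ : ℕ}

variable (R) in
/-- The linear functional on the exterior algebra of a free module that sends a wedge product of `ℓ`
vectors to the minor formed by their coordinates at `mu`, and all other degrees to zero. It serves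
to read off a coefficient of a linear combination of wedge products of basis vectors. -/
noncomputable def minor (mu : Fin ℓ → α) : ExteriorAlgebra R (α →₀ R) →ₗ[R] R :=
  ExteriorAlgebra.liftAlternating (R := R) (Pi.single ℓ
    ((Matrix.detRowAlternating (R := R) (n := Fin ℓ)).compLinearMap
      (LinearMap.pi fun j => Finsupp.lapply (mu j))))

theorem minor_ιMulti (mu : Fin ℓ → α) (v : Fin ℓ → α →₀ R) :
    minor R mu (ExteriorAlgebra.ιMulti R ℓ v) = (Matrix.of fun i j => v i (mu j)).det := by
  rw [minor, ExteriorAlgebra.liftAlternating_apply_ιMulti, Pi.single_eq_same]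
  rfl

theorem minor_ιMulti_of_ne {k : ℕ} (h : k ≠ ℓ) (mu : Fin ℓ → α) (v : Fin k → α →₀ R) :
    minor R mu (ExteriorAlgebra.ιMulti R k v) = 0 := by
  rw [minor, ExteriorAlgebra.liftAlternating_apply_ιMulti, Pi.single_eq_of_ne h]
  rfl

end Minor

section Wedge

variable (R) in
/-- The factor that a vertical edge in column `c` contributes to the wedge product of a row of
vertical edges. -/
noncomputable def column (c : ℕ) : Spin → ExteriorAlgebra R (ℕ →₀ R)
  | .plus => 1
  | .minus => ExteriorAlgebra.ι R (Finsupp.single c 1)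

variable (R) in
/-- The wedge product of the basis vectors of the columns with spin `-`, from right to left; it
represents the state `S` of a row of vertical edges in the fermionic Fock space. -/
noncomputable def wedge : {M : ℕ} → (Fin M → Spin) → ExteriorAlgebra R (ℕ →₀ R)
  | 0, _ => 1
  | M + 1, S => column R M (S (Fin.last M)) * wedge (Fin.init S)

theorem boundarySpin_congr {k ℓ : ℕ} {part : Fin k → ℕ} {part' : Fin ℓ → ℕ}
    (h : Set.range part = Set.range part') (M : ℕ) :
    boundarySpin M part = boundarySpin M part' := by
  funext c
  simp only [boundarySpin, ← Set.mem_range, h]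

theorem exists_eq_boundarySpin {M : ℕ} (S : Fin M → Spin) :
    ∃ (k : ℕ) (part : Fin k → ℕ), StrictAnti part ∧ (∀ i, part i < M) ∧
      S = boundarySpin M part := by
  obtain ⟨part, hanti, hrange⟩ :=
    exists_strictAnti_range_eq ((Finset.univ.filter (S · = .minus)).map Fin.valEmbedding)
  refine ⟨_, part, hanti, fun i => ?_, ?_⟩
  · have hi : part i ∈ Set.range part := ⟨i, rfl⟩
    rw [hrange, Finset.coe_map] at hi
    obtain ⟨c, -, hc⟩ := hi
    exact hc ▸ c.isLt
  · funext c
    have hc : (∃ i, part i = (c : ℕ)) ↔ S c = .minus := by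
      rw [← Set.mem_range, hrange]
      simp [Fin.val_inj]
    cases hS : S c <;> simp [boundarySpin, hc, hS]

theorem init_boundarySpin_of_zero_eq {ℓ M : ℕ} {part : Fin (ℓ + 1) → ℕ} (h0 : part 0 = M) :
    Fin.init (boundarySpin (M + 1) part) = boundarySpin M fun j => part j.succ := by
  funext c
  simp [Fin.init, boundarySpin, Fin.exists_fin_succ, h0, c.2.ne']

theorem wedge_boundarySpin {ℓ M : ℕ} {part : Fin ℓ → ℕ} (hpart : StrictAnti part)
    (hM : ∀ i, part i < M) :
    wedge R (boundarySpin M part) =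
      ExteriorAlgebra.ιMulti R ℓ fun i => Finsupp.single (part i) 1 := by
  induction M generalizing ℓ with
  | zero =>
    cases ℓ with
    | zero => simp [wedge]
    | succ ℓ => exact absurd (hM 0) (Nat.not_lt_zero _)
  | succ M ih =>
    by_cases h : ∃ i, part i = M
    · have hlast : boundarySpin (M + 1) part (Fin.last M) = .minus := if_pos h
      obtain ⟨i, hi⟩ := h
      cases ℓ with
      | zero => exact i.elim0
      | succ ℓ =>
        have h0 : part 0 = M :=
          le_antisymm (Nat.lt_succ_iff.1 (hM 0)) (hi ▸ hpart.antitone (Fin.zero_le i))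
        rw [wedge, hlast, init_boundarySpin_of_zero_eq h0,
          ih (part := fun j => part j.succ) (hpart.comp_strictMono Fin.strictMono_succ)
            fun j => h0 ▸ hpart (Fin.succ_pos j),
          ExteriorAlgebra.ιMulti_succ_apply, h0]
        rfl
    · have hlast : boundarySpin (M + 1) part (Fin.last M) = .plus := if_neg h
      rw [wedge, hlast, column, one_mul]
      exact ih hpart fun i =>
        lt_of_le_of_ne (Nat.lt_succ_iff.1 (hM i)) fun hi => h ⟨i, hi⟩

theorem minor_wedge {ℓ M : ℕ} {mu : Fin ℓ → ℕ} (hmu : StrictAnti mu) (hM : ∀ i, mu i < M)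
    (S : Fin M → Spin) :
    minor R mu (wedge R S) = if S = boundarySpin M mu then 1 else 0 := by
  split_ifs with h
  · rw [h, wedge_boundarySpin hmu hM, minor_ιMulti, det_single_self hmu.injective]
  · obtain ⟨k, part, hpart, hlt, rfl⟩ := exists_eq_boundarySpin S
    rw [wedge_boundarySpin hpart hlt]
    by_cases hk : k = ℓ
    · subst hk
      rw [minor_ιMulti, det_single_of_range_ne fun hrange => h (boundarySpin_congr hrange M)]
    · exact minor_ιMulti_of_ne hk _ _

end Wedge

/-- Parameters of free-fermionic six-vertex weights of a row. The six weights are `a` times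
`1, a₂, b₁, b₂, c₁, c₂`, where the free fermion condition `a₂ + b₁ b₂ = c₁ c₂` determines `a₂`;
having pulled out the factor `a`, this takes no division. -/
structure FreeFermion (R : Type*) where
  (a b₁ b₂ c₁ c₂ : R)

namespace FreeFermion

/-- The weight of a vertex, as a function of the spins on the left edge, on the vertical edge on
the side of the first row, on the right edge, and on the other vertical edge. This order covers both
`𝔖`, whose first row is at the bottom, and `𝔖*`, whose first row is at the top. -/
def vertex (p : FreeFermion R) (west inc east out : Spin) : R :=
  match west, inc, east, out with
  | .plus, .plus, .plus, .plus => p.a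
  | .minus, .minus, .minus, .minus => p.a * (p.c₁ * p.c₂ - p.b₁ * p.b₂)
  | .plus, .minus, .plus, .minus => p.a * p.b₁
  | .minus, .plus, .minus, .plus => p.a * p.b₂
  | .minus, .minus, .plus, .plus => p.a * p.c₁
  | .plus, .plus, .minus, .minus => p.a * p.c₂
  | _, _, _, _ => 0

/-- The monodromy matrix of a row: the partition functions of the row with given vertical edges, as
a matrix in the spins of its left and right boundary edges. -/
def monodromy (p : FreeFermion R) {M : ℕ} (S U : Fin M → Spin) : Matrix Spin Spin R :=
  (List.ofFn fun c => Matrix.of fun west east => p.vertex west (S c) east (U c)).prod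

theorem monodromy_snoc (p : FreeFermion R) {M : ℕ} (S : Fin (M + 1) → Spin) (U : Fin M → Spin)
    (u west east : Spin) :
    p.monodromy S (Fin.snoc U u : Fin (M + 1) → Spin) west east =
      ∑ h, p.monodromy (Fin.init S) U west h * p.vertex h (S (Fin.last M)) east u := by
  rw [monodromy, List.ofFn_succ', List.concat_eq_append, List.prod_append, List.prod_singleton,
    Matrix.mul_apply]
  simp only [monodromy, Fin.init, Matrix.of_apply, Fin.snoc_castSucc (α := fun _ => Spin),
    Fin.snoc_last (α := fun _ => Spin)]

/-- The row transfer matrix of a row whose left and right boundary edges are `+`. -/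
def transferMatrix (p : FreeFermion R) (M : ℕ) : Matrix (Fin M → Spin) (Fin M → Spin) R :=
  Matrix.of fun S U => p.monodromy S U .plus .plus

/-- The image, normalised by `a = 1`, of a particle that enters columns `0, …, M - 1` of a row from
the right: it moves to the left and leaves the row in one of these columns. -/
noncomputable def entering (p : FreeFermion R) : ℕ → ℕ →₀ R
  | 0 => 0
  | M + 1 => p.b₂ • p.entering M + p.c₂ • Finsupp.single M 1

/-- The action of a row on one-particle states, normalised by `a = 1`. -/
noncomputable def transfer (p : FreeFermion R) : (ℕ →₀ R) →ₗ[R] (ℕ →₀ R) :=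
  Finsupp.linearCombination R fun c => p.b₁ • Finsupp.single c 1 + p.c₁ • p.entering c

/-- The factor that the horizontal edge to the right of column `M - 1` contributes to the image of
the columns `0, …, M - 1` of a row. -/
noncomputable def horizontal (p : FreeFermion R) (M : ℕ) : Spin → ExteriorAlgebra R (ℕ →₀ R)
  | .plus => 1
  | .minus => ExteriorAlgebra.ι R (p.entering M)

theorem sum_vertex_smul (p : FreeFermion R) (M : ℕ) (s h : Spin) :
    ∑ u, ∑ h', p.vertex h' s h u • (column R M u * p.horizontal M h') =
      p.a • (p.horizontal (M + 1) h * ExteriorAlgebra.map p.transfer (column R M s)) := by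
  set e := ExteriorAlgebra.ι R (Finsupp.single M (1 : R)) with he
  set v := ExteriorAlgebra.ι R (p.entering M) with hv
  have hve : v * e = -(e * v) := eq_neg_of_add_eq_zero_left (ExteriorAlgebra.ι_add_mul_swap _ _)
  have hee : e * e = 0 := ExteriorAlgebra.ι_sq_zero _
  have hvv : v * v = 0 := ExteriorAlgebra.ι_sq_zero _
  have hmap : ExteriorAlgebra.map p.transfer e = p.b₁ • e + p.c₁ • v := by
    rw [he, ExteriorAlgebra.map_apply_ι, transfer, Finsupp.linearCombination_single, one_smul,
      map_add, map_smul, map_smul]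
  have hentering : ExteriorAlgebra.ι R (p.entering (M + 1)) = p.b₂ • v + p.c₂ • e := by
    rw [entering, map_add, map_smul, map_smul]
  -- For `s = h = -` this is `(b₂ v + c₂ e) (b₁ e + c₁ v) = (c₁ c₂ - b₁ b₂) e v`.
  cases s <;> cases h <;>
    simp only [sum_spin, vertex, column, horizontal, ← he, ← hv, hmap, hentering, map_one, mul_one,
      one_mul, zero_smul, zero_add, add_zero, add_mul, mul_add, smul_mul_assoc, mul_smul_comm, hve,
      hee, hvv, smul_zero]
  all_goals module

theorem sum_monodromy_smul_wedge (p : FreeFermion R) {M : ℕ} (S : Fin M → Spin) (h : Spin) :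
    ∑ U, p.monodromy S U .plus h • wedge R U =
      p.a ^ M • (p.horizontal M h * ExteriorAlgebra.map p.transfer (wedge R S)) := by
  induction M generalizing h with
  | zero => cases h <;> simp [monodromy, wedge, horizontal, entering]
  | succ M ih =>
    set W := ExteriorAlgebra.map p.transfer (wedge R (Fin.init S)) with hW
    calc ∑ U, p.monodromy S U .plus h • wedge R U
        = ∑ u, ∑ h', p.vertex h' (S (Fin.last M)) h u •
            (column R M u * ∑ U, p.monodromy (Fin.init S) U .plus h' • wedge R U) := by
          rw [sum_snoc]
          refine Finset.sum_congr rfl fun u _ => ?_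
          simp only [monodromy_snoc, wedge, Fin.init_snoc (α := fun _ => Spin),
            Fin.snoc_last (α := fun _ => Spin), Finset.sum_smul, Finset.mul_sum, Finset.smul_sum,
            mul_smul_comm, smul_smul, mul_comm (p.monodromy _ _ _ _)]
          exact Finset.sum_comm
      _ = p.a ^ M • ((∑ u, ∑ h', p.vertex h' (S (Fin.last M)) h u •
            (column R M u * p.horizontal M h')) * W) := by
          simp only [ih, ← hW, Finset.sum_mul, Finset.smul_sum, smul_mul_assoc, mul_smul_comm,
            mul_assoc, smul_comm (p.a ^ M)]
      _ = p.a ^ (M + 1) • (p.horizontal (M + 1) h *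
            ExteriorAlgebra.map p.transfer (wedge R S)) := by
          rw [sum_vertex_smul, wedge, map_mul, ← hW, smul_mul_assoc, smul_smul, ← pow_succ,
            mul_assoc]

theorem sum_transferMatrix_smul_wedge (p : FreeFermion R) {M : ℕ} (S : Fin M → Spin) :
    ∑ U, p.transferMatrix M S U • wedge R U =
      p.a ^ M • ExteriorAlgebra.map p.transfer (wedge R S) := by
  simpa [horizontal, transferMatrix] using p.sum_monodromy_smul_wedge S .plus

end FreeFermion

/-- The action of several rows on one-particle states, where the head of the list is the first
row. -/
noncomputable def transfers : List (FreeFermion R) → (ℕ →₀ R) →ₗ[R] (ℕ →₀ R)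
  | [] => LinearMap.id
  | p :: rows => transfers rows ∘ₗ p.transfer

theorem sum_prod_transferMatrix_smul_wedge (rows : List (FreeFermion R)) {M : ℕ}
    (S : Fin M → Spin) :
    ∑ U, (rows.map fun p => p.transferMatrix M).prod S U • wedge R U =
      (rows.map FreeFermion.a).prod ^ M • ExteriorAlgebra.map (transfers rows) (wedge R S) := by
  induction rows generalizing S with
  | nil => simp [transfers, Matrix.one_apply, ite_smul]
  | cons p rows ih =>
    simp only [List.map_cons, List.prod_cons, Matrix.mul_apply, Finset.sum_smul, mul_smul]
    rw [Finset.sum_comm]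
    have hrow := congrArg (ExteriorAlgebra.map (transfers rows)) (p.sum_transferMatrix_smul_wedge S)
    simp only [map_sum, map_smul] at hrow
    simp only [← Finset.smul_sum, ih]
    simp only [smul_comm (p.transferMatrix M S _)]
    rw [← Finset.smul_sum, hrow, transfers, ← ExteriorAlgebra.map_comp_map, AlgHom.comp_apply,
      mul_pow, smul_smul, mul_comm]

/-- The partition function of the model with `m` columns and free-fermionic rows `p`, with the
boundary conditions of `𝔖_{λ/μ}` and `𝔖*_{λ/μ}`. -/
def partition {N ℓ k : ℕ} (p : Fin N → FreeFermion R) (m : ℕ) (lam : Fin ℓ → ℕ)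
    (mu : Fin k → ℕ) : R :=
  ∑ s : Config N m with HasBoundary lam mu s, ∏ i : Fin N, ∏ c : Fin m,
    (p i).vertex (s.2 i c.castSucc) (s.1 i.castSucc c) (s.2 i c.succ) (s.1 i.succ c)

theorem partition_eq_prod_transferMatrix {N m ℓ k : ℕ} (p : Fin N → FreeFermion R)
    (lam : Fin ℓ → ℕ) (mu : Fin k → ℕ) :
    partition p m lam mu = (List.ofFn fun i => (p i).transferMatrix m).prod
      (boundarySpin m lam) (boundarySpin m mu) := by
  rw [partition, prod_ofFn_apply, Finset.sum_filter, Finset.sum_filter, Fintype.sum_prod_type]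
  refine Finset.sum_congr rfl fun v _ => ?_
  simp only [HasBoundary, ← and_assoc, ite_and (_ ∧ _)]
  split_ifs
  · simp only [FreeFermion.transferMatrix, FreeFermion.monodromy, Matrix.of_apply, prod_ofFn_apply,
      Finset.sum_filter, Finset.prod_univ_sum, Fintype.piFinset_univ, Finset.prod_ite_zero,
      Finset.mem_univ, true_implies]
  · exact Finset.sum_const_zero

theorem partition_eq_pow_mul_det {N ℓ m : ℕ} (p : Fin N → FreeFermion R) {lam mu : Fin ℓ → ℕ}
    (hlam : StrictAnti lam) (hmu : StrictAnti mu) (hlam_lt : ∀ i, lam i < m)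
    (hmu_lt : ∀ i, mu i < m) :
    partition p m lam mu = (∏ i, (p i).a) ^ m *
      (Matrix.of fun i j => transfers (List.ofFn p) (Finsupp.single (lam i) 1) (mu j)).det := by
  have h := congrArg (minor R mu)
    (sum_prod_transferMatrix_smul_wedge (List.ofFn p) (boundarySpin m lam))
  simpa [partition_eq_prod_transferMatrix, Function.comp_def, List.prod_ofFn,
    minor_wedge hmu hmu_lt, wedge_boundarySpin hlam hlam_lt, ExteriorAlgebra.map_apply_ιMulti,
    minor_ιMulti] using h

theorem partition_singleton {N m : ℕ} (p : Fin N → FreeFermion R) {i j : ℕ} (hi : i < m)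
    (hj : j < m) :
    partition p m ![i] ![j] =
      (∏ k, (p k).a) ^ m * transfers (List.ofFn p) (Finsupp.single i 1) j := by
  rw [partition_eq_pow_mul_det p (Subsingleton.strictAnti _) (Subsingleton.strictAnti _)
    (by simpa using hi) (by simpa using hj)]
  simp

theorem weight_eq_vertex (x y A B : R) (west north east south : Spin) :
    weight x y A B west north east south = FreeFermion.vertex
      { a := A, b₁ := B, b₂ := x, c₁ := (x + y) * B, c₂ := 1 } west south east north := by
  cases west <;> cases north <;> cases east <;> cases south <;>
    simp only [weight, FreeFermion.vertex] <;> ring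

theorem weightStar_eq_vertex (x y : R) (A B : Rˣ) (west north east south : Spin) :
    weightStar x y A B west north east south = FreeFermion.vertex
      { a := ↑A⁻¹, b₁ := ↑B⁻¹, b₂ := y, c₁ := ↑B⁻¹, c₂ := x + y } west north east south := by
  cases west <;> cases north <;> cases east <;> cases south <;>
    simp only [weightStar, FreeFermion.vertex] <;> ring

theorem Z_eq_partition {N ℓ k : ℕ} (x y A B : Fin N → R) (m : ℕ) (lam : Fin ℓ → ℕ)
    (mu : Fin k → ℕ) :
    Z x y A B m lam mu = partition
      (fun i => { a := A i, b₁ := B i, b₂ := x i, c₁ := (x i + y i) * B i, c₂ := 1 })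
      m lam mu := by
  simp only [Z, partition, weight_eq_vertex]

theorem ZStar_eq_partition {N ℓ k : ℕ} (x y : Fin N → R) (A B : Fin N → Rˣ) (m : ℕ)
    (lam : Fin ℓ → ℕ) (mu : Fin k → ℕ) :
    ZStar x y A B m lam mu = partition
      (fun i => { a := ↑(A i)⁻¹, b₁ := ↑(B i)⁻¹, b₂ := y i, c₁ := ↑(B i)⁻¹, c₂ := x i + y i })
      m lam mu := by
  simp only [ZStar, partition, weightStar_eq_vertex]

end SixVertex

theorem mainTheorem9_general {R : Type*} [CommRing R] {N ℓ : ℕ}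
    (p : Fin N → SixVertex.FreeFermion R) {lam mu : Fin ℓ → ℕ} (hlam : StrictAnti lam)
    (hmu : StrictAnti mu) {M : ℕ} {m : Fin ℓ → Fin ℓ → ℕ}
    (hm : ∀ i j, lam i < m i j ∧ mu j < m i j)
    (hM : ∀ σ : Equiv.Perm (Fin ℓ), M = ∑ i, m i (σ i)) :
    SixVertex.partition p M lam mu =
      (Matrix.of fun i j => SixVertex.partition p (m i j) ![lam i] ![mu j]).det := by
  have hle : ∀ i j, m i j ≤ M := SixVertex.le_of_forall_eq_sum_perm hM
  rw [SixVertex.partition_eq_pow_mul_det p hlam hmu (fun i => (hm i i).1.trans_le (hle i i))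
    fun i => (hm i i).2.trans_le (hle i i), ← SixVertex.det_of_pow_mul hM]
  simp only [SixVertex.partition_singleton p (hm _ _).1 (hm _ _).2]

theorem mainTheorem9 {R : Type*} [CommRing R] {N ℓ : ℕ} (x y : Fin N → R)
    (lam mu : Fin ℓ → ℕ) (hlam : StrictAnti lam) (hmu : StrictAnti mu)
    (M : ℕ) (m : Fin ℓ → Fin ℓ → ℕ)
    (hm : ∀ i j, lam i < m i j ∧ mu j < m i j)
    (hM : ∀ σ : Equiv.Perm (Fin ℓ), M = ∑ i, m i (σ i)) :
    (∀ A B : Fin N → R,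
      SixVertex.Z x y A B M lam mu =
        Matrix.det (Matrix.of fun i j : Fin ℓ =>
          SixVertex.Z x y A B (m i j) ![lam i] ![mu j])) ∧
    (∀ A B : Fin N → Rˣ,
      SixVertex.ZStar x y A B M lam mu =
        Matrix.det (Matrix.of fun i j : Fin ℓ =>
          SixVertex.ZStar x y A B (m i j) ![lam i] ![mu j])) := by
  simp only [SixVertex.Z_eq_partition, SixVertex.ZStar_eq_partition]
  exact ⟨fun _ _ => mainTheorem9_general _ hlam hmu hm hM,
    fun _ _ => mainTheorem9_general _ hlam hmu hm hM⟩
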